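/- Consider $n\ge 1$ processes that all repeatedly execute the scan-validate pattern $SCU(0,1)$ (read a shared register $R$, then attempt a CAS on $R$ with the value read; on failure restart, on success a new operation begins) under the uniform scheduler, which at every step lets one of the $n$ processes, chosen uniformly at random, take a step. The \emph{system chain} is the Markov chain on the states $(a,b)$ with $a,b\ge 0$, $a+b\le n$, $(a,b)\ne(0,n)$, where $a$ processes are about to read, $b$ processes are about to CAS with an invalid value of $R$, and the remaining $n-a-b$ processes are about to CAS with the current value of $R$. Its transitions are \[ (a,b)\to(a-1,b)\ \text{ with probability } \tfrac an \quad (a>0), \] \[ (a,b)\to(a+1,b-1)\ \text{ with probability } \tfrac bn \quad (b>0), \] \[ (a,b)\to(a+1,\,n-a-1)\ \text{ with probability } \tfrac{n-a-b}n=1-\tfrac{a+b}n \quad (a+b<n), \] and a transition of the third kind is a \emph{success} (a successful CAS operation; all other processes holding the current value then hold an invalid one). There is an absolute constant $C>0$ such that for every $n\ge 1$ the following holds. The system chain has a unique stationary distribution $\pi$. If $(X_t)_{t\ge 0}$ is the system chain with initial distribution $\pi$, then a step is a success with positive probability, and the expected number of steps between two consecutive successes satisfies \[ W=\mathbb E\bigl[\min\{m\ge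 1:\ \text{step } m \text{ is a success}\}\ \big|\ \text{step } 0 \text{ is a success}\bigr]\le C\sqrt n , \] where step $t$ is the transition from $X_t$ to $X_{t+1}$. That is, $W=O(\sqrt n)$. -/

import Mathlib

open MeasureTheory ProbabilityTheory
open scoped ENNReal Matrix

/-- A state `(a, b)` of the system chain of the scan-validate pattern with `n` processes:
`a` processes are about to read (extended local state `Read`), `b` processes are about to CAS with
an invalid value of the register (`OldCAS`), and the remaining `n - a - b` processes are about to
CAS with the current value (`CCAS`). The state `(0, n)` does not exist. -/
abbrev SysState (n : ℕ) : Type :=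
  {p : Fin (n + 1) × Fin (n + 1) //
    (p.1 : ℕ) + (p.2 : ℕ) ≤ n ∧ ¬ ((p.1 : ℕ) = 0 ∧ (p.2 : ℕ) = n)}

namespace SysState

variable {n : ℕ}

/-- The number of processes in state `Read`. -/
def read (x : SysState n) : ℕ := (x.1.1 : ℕ)

/-- The number of processes in state `OldCAS`. -/
def oldCAS (x : SysState n) : ℕ := (x.1.2 : ℕ)

/-- The number of processes in state `CCAS` (no truncation occurs, as `a + b ≤ n`). -/
def ccas (x : SysState n) : ℕ := n - (x.read + x.oldCAS)

/-- A `Read` process takes a step and becomes `CCAS`: `(a, b) → (a - 1, b)`. -/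
def IsReadStep (x y : SysState n) : Prop :=
  0 < x.read ∧ y.read + 1 = x.read ∧ y.oldCAS = x.oldCAS

/-- An `OldCAS` process takes a step; its CAS fails and it becomes `Read`:
`(a, b) → (a + 1, b - 1)`. -/
def IsFailStep (x y : SysState n) : Prop :=
  0 < x.oldCAS ∧ y.read = x.read + 1 ∧ y.oldCAS + 1 = x.oldCAS

/-- A `CCAS` process takes a step; its CAS succeeds, it becomes `Read`, and all other `CCAS`
processes become `OldCAS`: `(a, b) → (a + 1, n - a - 1)`. The three kinds of steps are mutually
exclusive, so this also says which transitions of the chain are successful CAS operations. -/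
def IsSuccess (x y : SysState n) : Prop :=
  0 < x.ccas ∧ y.read = x.read + 1 ∧ y.read + y.oldCAS = n

end SysState

open Classical in
/-- The transition matrix of the system chain: the process that takes the next step is chosen
uniformly at random among the `n` processes. -/
noncomputable def systemChain (n : ℕ) : Matrix (SysState n) (SysState n) ℝ := fun x y =>
  (if SysState.IsReadStep x y then (x.read : ℝ) / n else 0) +
  (if SysState.IsFailStep x y then (x.oldCAS : ℝ) / n else 0) +
  (if SysState.IsSuccess x y then (x.ccas : ℝ) / n else 0)

/-- `π` is a stationary distribution of the chain with transition matrix `P`: a probability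
(row) vector with `π P = π`. -/
def IsStationaryDistribution {S : Type*} [Fintype S] (P : Matrix S S ℝ) (π : S → ℝ) : Prop :=
  π ∈ stdSimplex ℝ S ∧ π ᵥ* P = π

/-- The process `X` on the probability space `(Ω, μ)` is a time-invariant Markov chain with
initial distribution `lam` and transition matrix `P`. -/
structure IsMarkovChain {S Ω : Type*} [MeasurableSpace Ω] (P : Matrix S S ℝ) (lam : S → ℝ)
    (μ : Measure Ω) (X : ℕ → Ω → S) : Prop where
  measurableSet_eq : ∀ t s, MeasurableSet {ω | X t ω = s}
  initial : ∀ s, μ.real {ω | X 0 ω = s} = lam s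
  step : ∀ (t : ℕ) (p : ℕ → S), μ.real {ω | ∀ i ≤ t + 1, X i ω = p i} =
    μ.real {ω | ∀ i ≤ t, X i ω = p i} * P (p t) (p (t + 1))

/-- The event that the step of the trajectory `X` from time `t` to time `t + 1` is a successful
CAS operation. -/
def successAt {n : ℕ} {Ω : Type*} (X : ℕ → Ω → SysState n) (t : ℕ) : Set Ω :=
  {ω | SysState.IsSuccess (X t ω) (X (t + 1) ω)}

/-- The number of steps from step `0` to the next successful step: the least `m ≥ 1` such that
step `m` is a successful CAS operation (`∞` if there is none). -/
noncomputable def stepsToNextSuccess {n : ℕ} {Ω : Type*} (X : ℕ → Ω → SysState n) (ω : Ω) : ℝ≥0∞ :=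
  ⨅ (m : ℕ) (_ : 1 ≤ m ∧ ω ∈ successAt X m), (m : ℝ≥0∞)

/-- The expected number of steps between two consecutive successes along the trajectory `X`:
the expectation of the number of steps until the next success, given that step `0` is a success. -/
noncomputable def expectedStepsBetweenSuccesses {n : ℕ} {Ω : Type*} [MeasurableSpace Ω]
    (μ : Measure Ω) (X : ℕ → Ω → SysState n) : ℝ≥0∞ :=
  ∫⁻ ω, stepsToNextSuccess X ω ∂(μ[|successAt X 0])

/-! Let `a`, `b`, `c` count the processes about to read, about to fail, and about to succeed; a step
succeeds with probability `c / n`. Stationarity forces the mean drift of every function to vanish.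
The drifts of `a`, `c`, `c ^ 2` give E a = n/2, E c² = E a and E c³ = E a(2c + 1) ≤ n(2 E c + 1).
Cauchy–Schwarz, (E c²)² ≤ E c · E c³, then yields n/4 ≤ E c (2 E c + 1), hence E c ≥ √n/8
(`sqrt_div_le_sum_mul_ccas`). So a step succeeds with probability at least 1/(8√n), and Kac's
inequality (`expectedStepsBetweenSuccesses_le`), a telescoping sum for a stationary process, bounds
W by 8√n. Uniqueness of `π` holds because every nonzero nonnegative invariant vector charges the
all-readers state. -/

/-! ### Stationary distributions of finite stochastic matrices -/

section Stationary

variable {S : Type*} [Fintype S]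

/-- If `v` is a left fixed vector of a stochastic matrix, so is its entrywise absolute value. -/
theorem abs_vecMul_eq_of_stochastic {P : Matrix S S ℝ} (hP : ∀ x y, 0 ≤ P x y)
    (hrow : ∀ x, ∑ y, P x y = 1) {v : S → ℝ} (hv : v ᵥ* P = v) :
    (fun x => |v x|) ᵥ* P = fun x => |v x| := by
  have hle : ∀ y ∈ Finset.univ, |v y| ≤ ((fun x => |v x|) ᵥ* P) y := by
    intro y _
    have h : v y = ∑ x, v x * P x y := (congrFun hv y).symm
    calc |v y| = |∑ x, v x * P x y| := by rw [← h]
      _ ≤ ∑ x, |v x * P x y| := Finset.abs_sum_le_sum_abs _ _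
      _ = ∑ x, |v x| * P x y := by
        refine Finset.sum_congr rfl fun x _ => ?_
        rw [abs_mul, abs_of_nonneg (hP x y)]
  -- Rows summing to 1 preserve total mass, so the entrywise inequality `hle` must be an equality.
  have hsum : ∑ y, |v y| = ∑ y, ((fun x => |v x|) ᵥ* P) y := by
    simp only [Matrix.vecMul, dotProduct]
    rw [Finset.sum_comm]
    simp [← Finset.mul_sum, hrow]
  funext y
  exact ((Finset.sum_eq_sum_iff_of_le hle).1 hsum y (Finset.mem_univ y)).symm

/-- A stochastic matrix on a finite nonempty type has a stationary distribution. -/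
theorem exists_isStationaryDistribution [Nonempty S] {P : Matrix S S ℝ} (hP : ∀ x y, 0 ≤ P x y)
    (hrow : ∀ x, ∑ y, P x y = 1) : ∃ π, IsStationaryDistribution P π := by
  classical
  -- The constant vector is a right null vector; singularity supplies a left one.
  have hdet : (P - 1).det = 0 := by
    refine Matrix.exists_mulVec_eq_zero_iff.1 ⟨fun _ => 1, ?_, ?_⟩
    · intro h
      exact one_ne_zero (congrFun h (Classical.arbitrary S))
    · funext x
      simp [Matrix.mulVec, dotProduct, hrow, Matrix.one_apply]
  obtain ⟨v, hv0, hv⟩ := Matrix.exists_vecMul_eq_zero_iff.2 hdet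
  have hv' : v ᵥ* P = v := by
    rwa [Matrix.vecMul_sub, Matrix.vecMul_one, sub_eq_zero] at hv
  have habs := abs_vecMul_eq_of_stochastic hP hrow hv'
  have hpos : 0 < ∑ x, |v x| := by
    obtain ⟨x, hx⟩ := Function.ne_iff.1 hv0
    exact Finset.sum_pos' (fun _ _ => abs_nonneg _) ⟨x, Finset.mem_univ x, abs_pos.2 hx⟩
  refine ⟨(∑ x, |v x|)⁻¹ • fun x => |v x|, ⟨fun x => ?_, ?_⟩, ?_⟩
  · exact mul_nonneg (inv_nonneg.2 hpos.le) (abs_nonneg _)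
  · simp only [Pi.smul_apply, smul_eq_mul, ← Finset.mul_sum]
    exact inv_mul_cancel₀ hpos.ne'
  · rw [Matrix.smul_vecMul, habs]

/-- If all nonzero nonnegative left fixed vectors of a stochastic matrix charge a common state,
then its stationary distribution is unique. -/
theorem IsStationaryDistribution.eq_of_forall_pos {P : Matrix S S ℝ} (hP : ∀ x y, 0 ≤ P x y)
    (hrow : ∀ x, ∑ y, P x y = 1) (o : S)
    (ho : ∀ w : S → ℝ, (∀ x, 0 ≤ w x) → w ≠ 0 → w ᵥ* P = w → 0 < w o)
    {π ρ : S → ℝ} (hπ : IsStationaryDistribution P π) (hρ : IsStationaryDistribution P ρ) :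
    π = ρ := by
  by_contra hne
  set v : S → ℝ := π - ρ with hvdef
  have hv : v ᵥ* P = v := by rw [hvdef, Matrix.sub_vecMul, hπ.2, hρ.2]
  have habs := abs_vecMul_eq_of_stochastic hP hrow hv
  have hsum : ∑ x, v x = 0 := by
    simp [hvdef, Finset.sum_sub_distrib, hπ.1.2, hρ.1.2]
  have hv0 : v ≠ 0 := sub_ne_zero.2 hne
  -- Both |v| + v and |v| - v are nonnegative, invariant and, as `v` has zero sum, nonzero. Both
  -- would be positive at `o`, where one of them vanishes.
  have key : ∀ u : S → ℝ, u ᵥ* P = u → u ≠ 0 → ∑ x, u x = 0 →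
      (fun x => |u x|) ᵥ* P = (fun x => |u x|) → 0 < |u o| + u o := by
    intro u hu hu0 hs hua
    refine ho ((fun x => |u x|) + u) (fun x => ?_) (fun h => hu0 ?_) ?_
    · have := neg_abs_le (u x)
      simp only [Pi.add_apply]
      linarith
    · have hle : ∀ x, u x ≤ 0 := fun x => by
        have := congrFun h x
        simp only [Pi.add_apply, Pi.zero_apply] at this
        linarith [abs_nonneg (u x)]
      funext x
      exact (Finset.sum_eq_zero_iff_of_nonpos fun x _ => hle x).1 hs x (Finset.mem_univ x)
    · rw [Matrix.add_vecMul, hua, hu]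
  have h1 := key v hv hv0 hsum habs
  have h2 := key (-v) (by rw [Matrix.neg_vecMul, hv]) (neg_ne_zero.2 hv0) (by simp [hsum])
    (by simpa using habs)
  simp only [Pi.neg_apply, abs_neg] at h2
  rcases le_total 0 (v o) with h | h
  · rw [abs_of_nonneg h] at h2; linarith
  · rw [abs_of_nonpos h] at h1; linarith

/-- Under a stationary distribution the one-step drift of any function has mean zero. -/
theorem IsStationaryDistribution.sum_mul_sum_eq {P : Matrix S S ℝ} {π : S → ℝ}
    (hπ : IsStationaryDistribution P π) (f : S → ℝ) :
    ∑ x, π x * ∑ y, P x y * f y = ∑ x, π x * f x := by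
  have h : π ⬝ᵥ (P *ᵥ f) = π ⬝ᵥ f := by rw [Matrix.dotProduct_mulVec, hπ.2]
  exact h

end Stationary

/-! ### Shift invariance of a stationary Markov chain -/

section MarkovChain

variable {S Ω : Type*} [MeasurableSpace Ω]

theorem measureReal_setOf_eq_sum {β : Type*} [Fintype β] (μ : Measure Ω) [IsFiniteMeasure μ]
    {f : Ω → β} (hf : ∀ b, MeasurableSet {ω | f ω = b}) (q : β → Prop) [DecidablePred q] :
    μ.real {ω | q (f ω)} = ∑ b, if q b then μ.real {ω | f ω = b} else 0 := by
  have h : {ω | q (f ω)} = ⋃ b ∈ Finset.univ.filter q, {ω | f ω = b} := by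
    ext ω; simp
  rw [h, measureReal_biUnion_finset _ (fun b _ => hf b), Finset.sum_filter]
  intro b _ c _ hbc
  exact Set.disjoint_left.2 fun ω hb hc => hbc (hb.symm.trans hc)

variable {P : Matrix S S ℝ} {π : S → ℝ} {μ : Measure Ω} {X : ℕ → Ω → S}

theorem IsMarkovChain.measurableSet_path (hX : IsMarkovChain P π μ X) (t k : ℕ) (p : ℕ → S) :
    MeasurableSet {ω | ∀ i ≤ t, X (i + k) ω = p i} := by
  have h : {ω | ∀ i ≤ t, X (i + k) ω = p i} = ⋂ i ∈ Set.Iic t, {ω | X (i + k) ω = p i} := by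
    ext ω; simp
  rw [h]
  exact MeasurableSet.biInter (Set.to_countable _) fun i _ => hX.measurableSet_eq _ _

theorem IsMarkovChain.measurableSet_of_path [Finite S] (hX : IsMarkovChain P π μ X) (t k : ℕ)
    (q : (Fin (t + 1) → S) → Prop) :
    MeasurableSet {ω | q fun i => X (i + k) ω} := by
  have h : {ω | q fun i => X (i + k) ω} =
      ⋃ p ∈ {p | q p}, {ω | (fun i : Fin (t + 1) => X (i + k) ω) = p} := by
    ext ω; simp
  rw [h]
  refine MeasurableSet.biUnion (Set.to_countable _) fun p _ => ?_
  simp only [funext_iff, Set.ofPred_forall]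
  exact MeasurableSet.iInter fun i => hX.measurableSet_eq _ _

variable [Fintype S] [IsProbabilityMeasure μ]

theorem IsMarkovChain.measureReal_shift_eq_sum (hX : IsMarkovChain P π μ X) (t : ℕ) (p : ℕ → S) :
    μ.real {ω | ∀ i ≤ t, X (i + 1) ω = p i} =
      ∑ r, μ.real {ω | ∀ i ≤ t + 1, X i ω = Nat.casesOn i r p} := by
  have h : {ω | ∀ i ≤ t, X (i + 1) ω = p i} =
      ⋃ r ∈ (Finset.univ : Finset S), {ω | ∀ i ≤ t + 1, X i ω = Nat.casesOn i r p} := by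
    ext ω
    simp only [Set.mem_ofPred_eq, Finset.mem_univ, Set.iUnion_true, Set.mem_iUnion]
    constructor
    · intro h
      refine ⟨X 0 ω, fun i hi => ?_⟩
      cases i with
      | zero => rfl
      | succ i => exact h i (by omega)
    · rintro ⟨r, hr⟩ i hi
      exact hr (i + 1) (by omega)
  rw [h, measureReal_biUnion_finset]
  · intro b _ c _ hbc
    exact Set.disjoint_left.2 fun ω hb hc =>
      hbc ((hb 0 (Nat.zero_le _)).symm.trans (hc 0 (Nat.zero_le _)))
  · intro r _
    exact hX.measurableSet_path (t + 1) 0 fun i => Nat.casesOn i r p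

/-- A Markov chain started in a stationary distribution is a stationary process. -/
theorem IsMarkovChain.measureReal_shift (hX : IsMarkovChain P π μ X)
    (hπ : IsStationaryDistribution P π) (t : ℕ) (p : ℕ → S) :
    μ.real {ω | ∀ i ≤ t, X (i + 1) ω = p i} = μ.real {ω | ∀ i ≤ t, X i ω = p i} := by
  induction t with
  | zero =>
    rw [hX.measureReal_shift_eq_sum]
    simp_rw [hX.step]
    simp only [Nat.le_zero_eq, forall_eq, hX.initial]
    exact congrFun hπ.2 (p 0)
  | succ t ih =>
    rw [hX.measureReal_shift_eq_sum, hX.step t p, ← ih, hX.measureReal_shift_eq_sum,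
      Finset.sum_mul]
    exact Finset.sum_congr rfl fun r _ => hX.step (t + 1) _

/-- An event on a finite time window is a finite disjoint union of single paths, so invariance for
paths suffices. -/
theorem IsMarkovChain.measure_shift_of_path (hX : IsMarkovChain P π μ X)
    (hπ : IsStationaryDistribution P π) (t : ℕ) (q : (Fin (t + 1) → S) → Prop) :
    μ {ω | q fun i => X (i + 1) ω} = μ {ω | q fun i => X i ω} := by
  classical
  change _ = μ {ω | q fun i => X (i + 0) ω}
  rw [← measureReal_eq_measureReal_iff,
    measureReal_setOf_eq_sum μ (fun p => hX.measurableSet_of_path t 1 (· = p)) q,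
    measureReal_setOf_eq_sum μ (fun p => hX.measurableSet_of_path t 0 (· = p)) q]
  refine Finset.sum_congr rfl fun p _ => ?_
  -- The finite path is extended to `ℕ` by reduction mod `t + 1`; values beyond `t` play no role.
  have h : ∀ k, {ω | (fun i : Fin (t + 1) => X (i + k) ω) = p} =
      {ω | ∀ i ≤ t, X (i + k) ω = (fun j => p (Fin.ofNat (t + 1) j)) i} := by
    intro k
    ext ω
    simp only [Set.mem_ofPred_eq, funext_iff]
    constructor
    · intro h i hi
      have := h ⟨i, by omega⟩
      simp only at this
      rw [this]
      congr 1
      ext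
      simp [Nat.mod_eq_of_lt (show i < t + 1 by omega)]
    · intro h i
      have := h i (by omega)
      rw [this]
      congr 1
      ext
      simp
  rw [h 1, h 0, hX.measureReal_shift hπ]
  rfl

end MarkovChain

/-! ### Transitions of the system chain and its all-readers state -/

section Chain

namespace SysState

variable {n : ℕ}

theorem ext_iff_read_oldCAS {x y : SysState n} :
    x = y ↔ x.read = y.read ∧ x.oldCAS = y.oldCAS := by
  simp only [Subtype.ext_iff, Prod.ext_iff, Fin.ext_iff, read, oldCAS]

theorem exists_read_oldCAS {a b : ℕ} (h : a + b ≤ n) (h' : ¬(a = 0 ∧ b = n)) :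
    ∃ x : SysState n, x.read = a ∧ x.oldCAS = b :=
  ⟨⟨(⟨a, by omega⟩, ⟨b, by omega⟩), h, h'⟩, rfl, rfl⟩

theorem read_add_oldCAS_add_ccas (x : SysState n) : x.read + x.oldCAS + x.ccas = n := by
  have := x.2.1
  simp only [read, oldCAS, ccas]
  omega

open Classical in
/-- The sum over the targets of one kind of transition, when there is exactly one target unless
the rate vanishes. -/
theorem sum_ite_mul {R : SysState n → Prop} {r : ℝ} {i j : ℕ} (f : ℕ → ℕ → ℝ)
    (h : r ≠ 0 → ∃ z : SysState n, z.read = i ∧ z.oldCAS = j ∧ ∀ y, R y ↔ y = z) :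
    ∑ y : SysState n, (if R y then r else 0) * f y.read y.oldCAS = r * f i j := by
  by_cases hr : r = 0
  · simp [hr]
  · obtain ⟨z, hi, hj, hz⟩ := h hr
    simp [hz, hi, hj]

theorem exists_isReadStep_iff {x : SysState n} (hx : 0 < x.read) :
    ∃ z : SysState n, z.read = x.read - 1 ∧ z.oldCAS = x.oldCAS ∧ ∀ y, IsReadStep x y ↔ y = z := by
  have h := x.read_add_oldCAS_add_ccas
  obtain ⟨z, h1, h2⟩ := exists_read_oldCAS (n := n) (a := x.read - 1) (b := x.oldCAS)
    (by omega) (by omega)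
  refine ⟨z, h1, h2, fun y => ?_⟩
  rw [ext_iff_read_oldCAS, IsReadStep]
  omega

theorem exists_isFailStep_iff {x : SysState n} (hx : 0 < x.oldCAS) :
    ∃ z : SysState n, z.read = x.read + 1 ∧ z.oldCAS = x.oldCAS - 1 ∧
      ∀ y, IsFailStep x y ↔ y = z := by
  have h := x.read_add_oldCAS_add_ccas
  obtain ⟨z, h1, h2⟩ := exists_read_oldCAS (n := n) (a := x.read + 1) (b := x.oldCAS - 1)
    (by omega) (by omega)
  refine ⟨z, h1, h2, fun y => ?_⟩
  rw [ext_iff_read_oldCAS, IsFailStep]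
  omega

theorem exists_isSuccess_iff {x : SysState n} (hx : 0 < x.ccas) :
    ∃ z : SysState n, z.read = x.read + 1 ∧ z.oldCAS = n - (x.read + 1) ∧
      ∀ y, IsSuccess x y ↔ y = z := by
  have h := x.read_add_oldCAS_add_ccas
  obtain ⟨z, h1, h2⟩ := exists_read_oldCAS (n := n) (a := x.read + 1) (b := n - (x.read + 1))
    (by omega) (by omega)
  refine ⟨z, h1, h2, fun y => ?_⟩
  rw [ext_iff_read_oldCAS, IsSuccess]
  omega

end SysState

variable {n : ℕ}

theorem pos_of_natCast_div_ne_zero {k m : ℕ} (h : (k : ℝ) / m ≠ 0) : 0 < k := by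
  rcases Nat.eq_zero_or_pos k with rfl | hk
  · simp at h
  · exact hk

/-- Taking `f` on pairs of naturals lets each term be written even when its target is not a state;
its rate is then zero. -/
theorem sum_systemChain_mul (x : SysState n) (f : ℕ → ℕ → ℝ) :
    ∑ y, systemChain n x y * f y.read y.oldCAS =
      (x.read : ℝ) / n * f (x.read - 1) x.oldCAS +
      (x.oldCAS : ℝ) / n * f (x.read + 1) (x.oldCAS - 1) +
      (x.ccas : ℝ) / n * f (x.read + 1) (n - (x.read + 1)) := by
  simp only [systemChain, add_mul, Finset.sum_add_distrib]
  rw [SysState.sum_ite_mul f fun h => SysState.exists_isReadStep_iff (pos_of_natCast_div_ne_zero h),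
    SysState.sum_ite_mul f fun h => SysState.exists_isFailStep_iff (pos_of_natCast_div_ne_zero h),
    SysState.sum_ite_mul f fun h => SysState.exists_isSuccess_iff (pos_of_natCast_div_ne_zero h)]

theorem systemChain_nonneg (x y : SysState n) : 0 ≤ systemChain n x y := by
  unfold systemChain
  positivity

theorem SysState.cast_sum_eq (x : SysState n) :
    (x.read : ℝ) + x.oldCAS + x.ccas = n := by
  exact_mod_cast x.read_add_oldCAS_add_ccas

theorem sum_systemChain (hn : 1 ≤ n) (x : SysState n) : ∑ y, systemChain n x y = 1 := by
  have h := sum_systemChain_mul x fun _ _ => 1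
  simp only [mul_one] at h
  have hn' : (n : ℝ) ≠ 0 := by positivity
  rw [h, ← add_div, ← add_div, x.cast_sum_eq, div_self hn']

theorem systemChain_pos_of_isFailStep {x y : SysState n} (h : SysState.IsFailStep x y) :
    0 < systemChain n x y := by
  have h0 : 0 < x.oldCAS := h.1
  have := x.read_add_oldCAS_add_ccas
  have hn : 0 < n := by omega
  have h1 : (0 : ℝ) < (x.oldCAS : ℝ) / n := by positivity
  unfold systemChain
  rw [if_pos h]
  positivity

theorem ccas_div_le_systemChain {x y : SysState n} (h : SysState.IsSuccess x y) :
    (x.ccas : ℝ) / n ≤ systemChain n x y := by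
  unfold systemChain
  rw [if_pos h]
  exact le_add_of_nonneg_left (by positivity)

theorem systemChain_pos_of_isSuccess {x y : SysState n} (h : SysState.IsSuccess x y) :
    0 < systemChain n x y := by
  have h0 : 0 < x.ccas := h.1
  have := x.read_add_oldCAS_add_ccas
  have hn : 0 < n := by omega
  exact lt_of_lt_of_le (by positivity) (ccas_div_le_systemChain h)

/-- The state in which every process is about to read. -/
def SysState.allRead (hn : 1 ≤ n) : SysState n :=
  ⟨(⟨n, by omega⟩, ⟨0, by omega⟩), by simp, by simp; omega⟩

/-- Every nonzero nonnegative invariant vector of the system chain charges the state in which all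
processes are about to read: the support is closed under transitions, and from any other state the
number of readers can increase. -/
theorem allRead_pos_of_vecMul_eq (hn : 1 ≤ n) {w : SysState n → ℝ} (hw : ∀ x, 0 ≤ w x)
    (hw0 : w ≠ 0) (h : w ᵥ* systemChain n = w) : 0 < w (SysState.allRead hn) := by
  have hstep : ∀ x y, 0 < w x → 0 < systemChain n x y → 0 < w y := by
    intro x y hx hxy
    rw [← congrFun h y]
    exact Finset.sum_pos' (fun z _ => mul_nonneg (hw z) (systemChain_nonneg z y))
      ⟨x, Finset.mem_univ x, mul_pos hx hxy⟩
  obtain ⟨x₀, hx₀⟩ := Function.ne_iff.1 hw0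
  obtain ⟨x, hx, hmax⟩ := Finset.exists_max_image (Finset.univ.filter fun x => 0 < w x)
    SysState.read ⟨x₀, by simpa using (hw x₀).lt_of_ne' hx₀⟩
  simp only [Finset.mem_filter, Finset.mem_univ, true_and] at hx hmax
  have hb : x.oldCAS = 0 := by
    by_contra hb
    obtain ⟨z, h1, -, hz⟩ := SysState.exists_isFailStep_iff (Nat.pos_of_ne_zero hb)
    have := hmax z (hstep x z hx (systemChain_pos_of_isFailStep ((hz z).2 rfl)))
    omega
  have hc : x.ccas = 0 := by
    by_contra hc
    obtain ⟨z, h1, -, hz⟩ := SysState.exists_isSuccess_iff (Nat.pos_of_ne_zero hc)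
    have := hmax z (hstep x z hx (systemChain_pos_of_isSuccess ((hz z).2 rfl)))
    omega
  have hxe : x = SysState.allRead hn := by
    rw [SysState.ext_iff_read_oldCAS]
    have := x.read_add_oldCAS_add_ccas
    exact ⟨show x.read = n by omega, show x.oldCAS = 0 from hb⟩
  exact hxe ▸ hx

end Chain

/-! ### Moment identities from vanishing drift -/

section Moments

variable {n : ℕ}

/-- The generator of the system chain (multiplied by `n`) has mean zero under the stationary
distribution. -/
theorem IsStationaryDistribution.sum_mul_generator_eq_zero (hn : 1 ≤ n) {π : SysState n → ℝ}
    (hπ : IsStationaryDistribution (systemChain n) π) (g : ℝ → ℝ → ℝ) :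
    ∑ x, π x * (x.read * (g (x.read - 1) x.oldCAS - g x.read x.oldCAS) +
      x.oldCAS * (g (x.read + 1) (x.oldCAS - 1) - g x.read x.oldCAS) +
      x.ccas * (g (x.read + 1) (n - (x.read + 1)) - g x.read x.oldCAS)) = 0 := by
  have hn' : (n : ℝ) ≠ 0 := by positivity
  have h := hπ.sum_mul_sum_eq fun x => g x.read x.oldCAS
  rw [← sub_eq_zero, ← Finset.sum_sub_distrib] at h
  rw [← mul_zero (n : ℝ), ← h, Finset.mul_sum]
  refine Finset.sum_congr rfl fun x _ => ?_
  rw [sum_systemChain_mul x fun i j => g i j]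
  -- Natural subtraction truncates only where the prefactor is zero, so real subtraction may replace
  -- it.
  have h1 : (x.read : ℝ) * g ((x.read - 1 : ℕ) : ℝ) x.oldCAS =
      x.read * g (x.read - 1) x.oldCAS := by
    rcases Nat.eq_zero_or_pos x.read with h0 | h0
    · simp [h0]
    · rw [Nat.cast_sub h0, Nat.cast_one]
  have h2 : (x.oldCAS : ℝ) * g (x.read + 1) ((x.oldCAS - 1 : ℕ) : ℝ) =
      x.oldCAS * g (x.read + 1) (x.oldCAS - 1) := by
    rcases Nat.eq_zero_or_pos x.oldCAS with h0 | h0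
    · simp [h0]
    · rw [Nat.cast_sub h0, Nat.cast_one]
  have h3 : (x.ccas : ℝ) * g (x.read + 1) ((n - (x.read + 1) : ℕ) : ℝ) =
      x.ccas * g (x.read + 1) (n - (x.read + 1)) := by
    rcases Nat.eq_zero_or_pos x.ccas with h0 | h0
    · simp [h0]
    · have := x.read_add_oldCAS_add_ccas
      rw [Nat.cast_sub (by omega), Nat.cast_add, Nat.cast_one]
  simp only [mul_sub, ← h1, ← h2, ← h3, Nat.cast_add, Nat.cast_one]
  field_simp
  rw [← x.cast_sum_eq]
  ring

/-- The stationary mean of the number of processes about to CAS successfully is at least of order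
`√n`. -/
theorem IsStationaryDistribution.sqrt_div_le_sum_mul_ccas (hn : 1 ≤ n) {π : SysState n → ℝ}
    (hπ : IsStationaryDistribution (systemChain n) π) :
    √n / 8 ≤ ∑ x, π x * x.ccas := by
  have hsum : ∑ x, π x = 1 := hπ.1.2
  have hnn : ∀ x, 0 ≤ π x := hπ.1.1
  have e1 : ∑ x, π x * x.read = n / 2 := by
    have h := hπ.sum_mul_generator_eq_zero hn fun a _ => a
    have h' : ∑ x, (π x * n - 2 * (π x * x.read)) = 0 := by
      rw [← h]
      refine Finset.sum_congr rfl fun x _ => ?_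
      rw [← x.cast_sum_eq]; ring
    rw [Finset.sum_sub_distrib, ← Finset.sum_mul, ← Finset.mul_sum, hsum] at h'
    linarith
  -- A read raises `c` by 1, a failure leaves it alone, a success resets it to 0: the drift is a -
  -- c².
  have e2 : ∑ x, π x * (x.ccas : ℝ) ^ 2 = n / 2 := by
    have h := hπ.sum_mul_generator_eq_zero hn fun a b => n - a - b
    have h' : ∑ x, (π x * x.read - π x * (x.ccas : ℝ) ^ 2) = 0 := by
      rw [← h]
      refine Finset.sum_congr rfl fun x _ => ?_
      rw [← x.cast_sum_eq]; ring
    rw [Finset.sum_sub_distrib] at h'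
    linarith
  have e3 : ∑ x, π x * (x.ccas : ℝ) ^ 3 = ∑ x, π x * (x.read * (2 * x.ccas + 1)) := by
    have h := hπ.sum_mul_generator_eq_zero hn fun a b => (n - a - b) ^ 2
    have h' : ∑ x, (π x * (x.read * (2 * x.ccas + 1)) - π x * (x.ccas : ℝ) ^ 3) = 0 := by
      rw [← h]
      refine Finset.sum_congr rfl fun x _ => ?_
      rw [← x.cast_sum_eq]; ring
    rw [Finset.sum_sub_distrib] at h'
    linarith
  set m := ∑ x, π x * x.ccas with hm
  have hm0 : 0 ≤ m := Finset.sum_nonneg fun x _ => mul_nonneg (hnn x) (Nat.cast_nonneg _)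
  have hle : ∑ x, π x * (x.ccas : ℝ) ^ 3 ≤ n * (2 * m + 1) := by
    calc ∑ x, π x * (x.ccas : ℝ) ^ 3 = ∑ x, π x * (x.read * (2 * x.ccas + 1)) := e3
      _ ≤ ∑ x, π x * (n * (2 * x.ccas + 1)) := by
        refine Finset.sum_le_sum fun x _ => mul_le_mul_of_nonneg_left
          (mul_le_mul_of_nonneg_right ?_ (by positivity)) (hnn x)
        rw [← x.cast_sum_eq, add_assoc]
        exact le_add_of_nonneg_right (by positivity)
      _ = ∑ x, (n * 2 * (π x * x.ccas) + n * π x) :=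
        Finset.sum_congr rfl fun x _ => by ring
      _ = n * (2 * m + 1) := by
        rw [Finset.sum_add_distrib, ← Finset.mul_sum, ← Finset.mul_sum, hsum]; ring
  -- Cauchy–Schwarz with c² as the geometric mean of c and c³.
  have hcs : (n / 2 : ℝ) ^ 2 ≤ m * (n * (2 * m + 1)) := by
    rw [← e2]
    refine le_trans ?_ (mul_le_mul_of_nonneg_left hle hm0)
    exact Finset.sum_sq_le_sum_mul_sum_of_sq_le_mul _
      (fun x _ => mul_nonneg (hnn x) (by positivity))
      (fun x _ => mul_nonneg (hnn x) (by positivity)) fun x _ => le_of_eq (by ring)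
  have hn1 : (1 : ℝ) ≤ n := by exact_mod_cast hn
  have hquad : (n : ℝ) / 4 ≤ m * (2 * m + 1) := by
    have : (n : ℝ) * (n / 4) ≤ n * (m * (2 * m + 1)) := by linarith
    exact le_of_mul_le_mul_left this (by linarith)
  -- If m < √n/8, then m(2m + 1) < n/32 + √n/8 ≤ 5n/32 < n/4.
  by_contra! hlt
  have hs : √(n : ℝ) * √n = n := Real.mul_self_sqrt (by linarith)
  have hs1 : 1 ≤ √(n : ℝ) := Real.one_le_sqrt.2 hn1
  nlinarith

end Moments

/-! ### Kac's inequality and the success probability -/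

section Kac

variable {n : ℕ} {Ω : Type*}

/-- No step from time `k` up to time `k + m - 1` is a success. -/
def noSuccess (X : ℕ → Ω → SysState n) (k m : ℕ) : Set Ω :=
  {ω | ∀ i : Fin m, ¬SysState.IsSuccess (X (i + k) ω) (X (i + 1 + k) ω)}

theorem noSuccess_one_sdiff (X : ℕ → Ω → SysState n) (m : ℕ) :
    noSuccess X 1 m \ successAt X 0 = noSuccess X 0 (m + 1) := by
  ext ω
  simp only [noSuccess, successAt, Set.mem_sdiff, Set.mem_ofPred_eq, Fin.forall_fin_succ]
  exact and_comm

/-- Tail-sum formula: the waiting time T is the sum over m ≥ 0 of the indicators of T > m. -/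
theorem stepsToNextSuccess_le_tsum (X : ℕ → Ω → SysState n) (ω : Ω) :
    stepsToNextSuccess X ω ≤ ∑' m, (noSuccess X 1 m).indicator 1 ω := by
  classical
  by_cases h : ∃ k, ω ∈ successAt X (k + 1)
  · have hk := Nat.find_spec h
    set k := Nat.find h with hkdef
    calc stepsToNextSuccess X ω ≤ ((k + 1 : ℕ) : ℝ≥0∞) :=
        iInf₂_le (k + 1) ⟨by omega, hk⟩
      _ = ∑ m ∈ Finset.range (k + 1), (noSuccess X 1 m).indicator 1 ω := by
        rw [Finset.sum_congr rfl (g := fun _ => (1 : ℝ≥0∞))]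
        · simp
        · intro m hm
          refine Set.indicator_of_mem (fun i => ?_) _
          have := Finset.mem_range.1 hm
          exact Nat.find_min h (m := i) (by omega)
      _ ≤ _ := ENNReal.sum_le_tsum _
  · have h1 : ∀ m, (noSuccess X 1 m).indicator (1 : Ω → ℝ≥0∞) ω = 1 := fun m =>
      Set.indicator_of_mem (show ω ∈ noSuccess X 1 m from fun i hi => h ⟨i, hi⟩) _
    simp [h1]

variable [MeasurableSpace Ω] {P : Matrix (SysState n) (SysState n) ℝ} {π : SysState n → ℝ}
  {μ : Measure Ω} {X : ℕ → Ω → SysState n}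

theorem IsMarkovChain.measurableSet_noSuccess (hX : IsMarkovChain P π μ X) (k m : ℕ) :
    MeasurableSet (noSuccess X k m) :=
  hX.measurableSet_of_path m k fun p => ∀ i : Fin m, ¬SysState.IsSuccess (p i.castSucc) (p i.succ)

theorem IsMarkovChain.measurableSet_successAt_zero (hX : IsMarkovChain P π μ X) :
    MeasurableSet (successAt X 0) :=
  hX.measurableSet_of_path 1 0 fun p => SysState.IsSuccess (p 0) (p 1)

variable [IsProbabilityMeasure μ]

theorem IsMarkovChain.measure_noSuccess_one (hX : IsMarkovChain P π μ X)
    (hπ : IsStationaryDistribution P π) (m : ℕ) :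
    μ (noSuccess X 1 m) = μ (noSuccess X 0 m) :=
  hX.measure_shift_of_path hπ m
    fun p => ∀ i : Fin m, ¬SysState.IsSuccess (p i.castSucc) (p i.succ)

/-- By stationarity each summand equals `μ (noSuccess X 0 m) - μ (noSuccess X 0 (m + 1))`, so the
sum telescopes. -/
theorem IsMarkovChain.sum_measure_le_one (hX : IsMarkovChain P π μ X)
    (hπ : IsStationaryDistribution P π) (M : ℕ) :
    ∑ m ∈ Finset.range M, μ (noSuccess X 1 m ∩ successAt X 0) + μ (noSuccess X 0 M) ≤ 1 := by
  induction M with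
  | zero => simpa using prob_le_one
  | succ M ih =>
    rwa [Finset.sum_range_succ, add_assoc, ← noSuccess_one_sdiff,
      measure_inter_add_sdiff _ hX.measurableSet_successAt_zero, hX.measure_noSuccess_one hπ]

/-- One half of Kac's formula: the mean number of steps between successes is at most the inverse
of the probability of a success. -/
theorem IsMarkovChain.expectedStepsBetweenSuccesses_le (hX : IsMarkovChain P π μ X)
    (hπ : IsStationaryDistribution P π) :
    expectedStepsBetweenSuccesses μ X ≤ (μ (successAt X 0))⁻¹ := by
  rw [expectedStepsBetweenSuccesses, ProbabilityTheory.cond, lintegral_smul_measure, smul_eq_mul]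
  refine mul_le_of_le_one_right' ?_
  calc ∫⁻ ω in successAt X 0, stepsToNextSuccess X ω ∂μ
      ≤ ∫⁻ ω in successAt X 0, ∑' m, (noSuccess X 1 m).indicator 1 ω ∂μ :=
        lintegral_mono fun ω => stepsToNextSuccess_le_tsum X ω
    _ = ∑' m, μ (noSuccess X 1 m ∩ successAt X 0) := by
        rw [lintegral_tsum fun m =>
          (measurable_one.indicator (hX.measurableSet_noSuccess 1 m)).aemeasurable]
        refine tsum_congr fun m => ?_
        rw [lintegral_indicator_one (hX.measurableSet_noSuccess 1 m),
          Measure.restrict_apply (hX.measurableSet_noSuccess 1 m)]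
    _ ≤ 1 := ENNReal.tsum_le_of_sum_range_le fun M =>
        le_self_add.trans (hX.sum_measure_le_one hπ M)

theorem IsMarkovChain.sum_mul_ccas_div_le (hX : IsMarkovChain (systemChain n) π μ X)
    (hπ : IsStationaryDistribution (systemChain n) π) :
    (∑ x, π x * x.ccas) / n ≤ μ.real (successAt X 0) := by
  classical
  have hpair : ∀ b : SysState n × SysState n, {ω | (X 0 ω, X 1 ω) = b} =
      {ω | ∀ i ≤ 0 + 1, X i ω = (fun j => if j = 0 then b.1 else b.2) i} := by
    intro b
    ext ω
    simp [Prod.ext_iff, Nat.le_one_iff_eq_zero_or_eq_one]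
  have hsum : μ.real (successAt X 0) =
      ∑ x, ∑ y, if SysState.IsSuccess x y then π x * systemChain n x y else 0 := by
    refine (measureReal_setOf_eq_sum μ (f := fun ω => (X 0 ω, X 1 ω)) (fun b => ?_)
      fun b => SysState.IsSuccess b.1 b.2).trans ?_
    · rw [hpair]
      exact hX.measurableSet_path (0 + 1) 0 _
    · rw [Fintype.sum_prod_type]
      refine Finset.sum_congr rfl fun x _ => Finset.sum_congr rfl fun y _ => ?_
      rw [hpair, hX.step]
      simp [hX.initial]
  rw [hsum, Finset.sum_div]
  refine Finset.sum_le_sum fun x _ => ?_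
  have hterm : ∀ y, 0 ≤ if SysState.IsSuccess x y then π x * systemChain n x y else 0 := by
    intro y
    split_ifs
    · exact mul_nonneg (hπ.1.1 x) (systemChain_nonneg x y)
    · exact le_rfl
  rcases Nat.eq_zero_or_pos x.ccas with h0 | h0
  · simpa [h0] using Finset.sum_nonneg fun y _ => hterm y
  · obtain ⟨z, -, -, hz⟩ := SysState.exists_isSuccess_iff h0
    have hs := (hz z).2 rfl
    refine le_trans ?_ (Finset.single_le_sum (fun y _ => hterm y) (Finset.mem_univ z))
    rw [if_pos hs, mul_div_assoc]
    exact mul_le_mul_of_nonneg_left (ccas_div_le_systemChain hs) (hπ.1.1 x)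

end Kac

/-! ### Assembly with C = 8 -/

theorem mainTheorem2 :
    ∃ C : ℝ, 0 < C ∧ ∀ n : ℕ, 1 ≤ n →
      (∃! π : SysState n → ℝ, IsStationaryDistribution (systemChain n) π) ∧
      ∀ π : SysState n → ℝ, IsStationaryDistribution (systemChain n) π →
        ∀ (Ω : Type*) [MeasurableSpace Ω] (μ : Measure Ω) [IsProbabilityMeasure μ]
          (X : ℕ → Ω → SysState n), IsMarkovChain (systemChain n) π μ X →
          0 < μ (successAt X 0) ∧
          expectedStepsBetweenSuccesses μ X ≤ ENNReal.ofReal (C * Real.sqrt n) := by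
  refine ⟨8, by norm_num, fun n hn => ⟨?_, ?_⟩⟩
  · have : Nonempty (SysState n) := ⟨SysState.allRead hn⟩
    obtain ⟨π, hπ⟩ := exists_isStationaryDistribution systemChain_nonneg (sum_systemChain hn)
    exact ⟨π, hπ, fun ρ hρ => IsStationaryDistribution.eq_of_forall_pos systemChain_nonneg
      (sum_systemChain hn) (SysState.allRead hn)
      (fun w hw hw0 h => allRead_pos_of_vecMul_eq hn hw hw0 h) hρ hπ⟩
  · intro π hπ Ω _ μ _ X hX
    have hn1 : (0 : ℝ) < n := by exact_mod_cast hn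
    have hs : 0 < √(n : ℝ) := Real.sqrt_pos.2 hn1
    have hp : (8 * √(n : ℝ))⁻¹ ≤ μ.real (successAt X 0) := by
      refine le_trans (le_of_eq ?_) ((div_le_div_of_nonneg_right
        (hπ.sqrt_div_le_sum_mul_ccas hn) hn1.le).trans (hX.sum_mul_ccas_div_le hπ))
      nth_rewrite 3 [← Real.mul_self_sqrt hn1.le]
      field_simp
    have hp' : (ENNReal.ofReal (8 * √(n : ℝ)))⁻¹ ≤ μ (successAt X 0) := by
      rw [← ENNReal.ofReal_inv_of_pos (by positivity)]
      exact (ENNReal.ofReal_le_ofReal hp).trans_eq (ofReal_measureReal (measure_ne_top _ _))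
    refine ⟨lt_of_lt_of_le (ENNReal.inv_pos.2 ENNReal.ofReal_ne_top) hp', ?_⟩
    exact (hX.expectedStepsBetweenSuccesses_le hπ).trans (ENNReal.inv_le_iff_inv_le.1 hp')
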